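/- A standard triangular array (STA) is a triangular array $\{\xi_{n,k}\}_{n\ge 1,\,1\le k\le n}$ of real square-integrable random variables such that, for every $n\ge 1$, the variables $\xi_{n,1},\dots,\xi_{n,n}$ are independent, $\mathbb{E}[\xi_{n,k}]=0$ for all $k$, and $\sum_{k=1}^n \mathbb{E}[\xi_{n,k}^2]=1$. It satisfies Feller's negligibility condition if $\max_{1\le k\le n}\mathbb{E}[\xi_{n,k}^2]\to 0$ as $n\to\infty$. For real random variables $\eta,\eta'$ let $K(\eta,\eta')=\sup_{x\in\mathbb{R}}|\mathbb{P}[\eta\le x]-\mathbb{P}[\eta'\le x]|$ be the Kolmogorov distance, and put $$\widetilde{\mathrm{Lin}}_{1/2}(\{\xi_{n,k}\})=\limsup_{n\to\infty}\sum_{k=1}^n\mathbb{E}\Big[\xi_{n,k}^2\Big(1-e^{-\frac12\xi_{n,k}^2}\Big)\Big].$$ **Theorem.** There exists a constant $C_{1/2}$ with $0<C_{1/2}\le 30.3$ such that, for every STA $\{\xi_{n,k}\}$ satisfying Feller's negligibility condition and every standard normally distributed random variable $\xi$, $$\widetilde{\mathrm{Lin}}_{1/2}(\{\xi_{n,k}\})\le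 C_{1/2}\,\limsup_{n\to\infty}K\Big(\xi,\sum_{k=1}^n\xi_{n,k}\Big).$$ The constant does not depend on $\{\xi_{n,k}\}$. -/

import Mathlib

open MeasureTheory ProbabilityTheory Filter Topology

noncomputable section

/-- A standard triangular array. For `n ≥ 1` the `n`-th row consists of the `n` real random variables
`ξ n k`, `k : Fin n`, defined on the space `(Ω n, P n)`; all rows may live on the same space. There is
no row with index `0`, so the conditions are imposed for `n ≥ 1` only. -/
structure IsStandardTriangularArray {Ω : ℕ → Type*} [∀ n, MeasurableSpace (Ω n)]
    (P : ∀ n, Measure (Ω n)) (ξ : ∀ n, Fin n → Ω n → ℝ) : Prop where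
  square_integrable : ∀ n, 1 ≤ n → ∀ k, MemLp (ξ n k) 2 (P n)
  indep : ∀ n, 1 ≤ n → iIndepFun (ξ n) (P n)
  mean_zero : ∀ n, 1 ≤ n → ∀ k, ∫ ω, ξ n k ω ∂(P n) = 0
  sum_variance : ∀ n, 1 ≤ n → ∑ k, ∫ ω, (ξ n k ω) ^ 2 ∂(P n) = 1

/-- Feller's negligibility condition: `max_{k ≤ n} 𝔼[ξ_{n,k}²] → 0` as `n → ∞`. -/
def FellerNegligible {Ω : ℕ → Type*} [∀ n, MeasurableSpace (Ω n)]
    (P : ∀ n, Measure (Ω n)) (ξ : ∀ n, Fin n → Ω n → ℝ) : Prop :=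
  Tendsto (fun n => ⨆ k : Fin n, ∫ ω, (ξ n k ω) ^ 2 ∂(P n)) atTop (𝓝 0)

/-- The Kolmogorov distance between a random variable `X` on `(Ω, P)` and a random variable `Y` on
`(Ω', Q)`: the supremum over `x` of `|ℙ[X ≤ x] - ℙ[Y ≤ x]|`. -/
def kolmogorovDist {Ω Ω' : Type*} [MeasurableSpace Ω] [MeasurableSpace Ω']
    (P : Measure Ω) (X : Ω → ℝ) (Q : Measure Ω') (Y : Ω' → ℝ) : ℝ :=
  ⨆ x : ℝ, |P.real {ω | X ω ≤ x} - Q.real {ω | Y ω ≤ x}|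

/-- The relaxed Lindeberg index with respect to a weight function `φ` (used on `[0, ∞)` only):
`limsup_n ∑_{k ≤ n} 𝔼[ξ_{n,k}² φ(|ξ_{n,k}|)]`. -/
def relaxedLindebergIndexOf (φ : ℝ → ℝ) {Ω : ℕ → Type*} [∀ n, MeasurableSpace (Ω n)]
    (P : ∀ n, Measure (Ω n)) (ξ : ∀ n, Fin n → Ω n → ℝ) : ℝ :=
  limsup (fun n => ∑ k, ∫ ω, (ξ n k ω) ^ 2 * φ |ξ n k ω| ∂(P n)) atTop

/-- The weight function `φ_γ(x) = 1 - exp(-γ x²)`. -/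
def expWeight (γ x : ℝ) : ℝ := 1 - Real.exp (-γ * x ^ 2)

/-- The relaxed Lindeberg index with respect to `φ_γ`. -/
def relaxedLindebergIndex (γ : ℝ) {Ω : ℕ → Type*} [∀ n, MeasurableSpace (Ω n)]
    (P : ∀ n, Measure (Ω n)) (ξ : ∀ n, Fin n → Ω n → ℝ) : ℝ :=
  relaxedLindebergIndexOf (expWeight γ) P ξ

end

/-! The argument is Stein's method run backwards, with test function f(w) = (1 - exp(-3w²/2))/w. For
a row sum W with Kolmogorov distance κ to the Gaussian Z, E[W f(W)] is estimated twice. From below: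
w f(w) has total variation 2, so E[W f(W)] ≥ E[Z f(Z)] - 2κ = 1/2 - 2κ.

From above: E[W f(W)] = ∑ E[X_i f(V_i + X_i)] with V_i = W - X_i independent of the centred X_i, so
E f(V_i) may be subtracted. Replacing V_i by Z in the increment of f costs at most C E[X_i²], where
C bounds the change in E f'(· + x): 17δ for passing from V_i to W, with δ² a bound for the variances
in the row, and 4.3125κ for passing from W to Z, by the total variation of f'. For Gaussian Z,
`mul_integral_steinFn_add_gaussianReal_le` gives x E f(Z + x) ≤ x²/2 - (5/24) x²(1 - exp(-x²/2));
the last term is the integrand of the Lindeberg index.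

Since the variances sum to 1, the halves cancel: (5/24) · (index of the row) ≤ (2 + 4.3125)κ + 17δ.
Feller's condition sends δ to 0, and 6.3125 · 24/5 = 30.3. -/

noncomputable section

/-! ### Calculus of u ↦ (1 - exp(-u))/u, and numerical bounds -/

/-- The average of `exp (-s u)` over `s ∈ [0, 1]`, that is `(1 - exp (-u)) / u`. -/
def expMean (u : ℝ) : ℝ := ∫ s in (0 : ℝ)..1, Real.exp (-(s * u))

/-- Minus the derivative of `expMean`. -/
def expMoment (u : ℝ) : ℝ := ∫ s in (0 : ℝ)..1, s * Real.exp (-(s * u))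

lemma hasDerivAt_exp_neg_mul (s u : ℝ) :
    HasDerivAt (fun u : ℝ => Real.exp (-(s * u))) (-(s * Real.exp (-(s * u)))) u :=
  ((hasDerivAt_id' u).const_mul s).fun_neg.exp.congr_deriv (by ring)

lemma hasDerivAt_expMean (u : ℝ) : HasDerivAt expMean (-expMoment u) u := by
  have h := intervalIntegral.hasDerivAt_integral_of_dominated_loc_of_deriv_le
    (μ := volume) (a := (0 : ℝ)) (b := 1) (𝕜 := ℝ) (x₀ := u) (s := Metric.ball u 1)
    (F := fun x s => Real.exp (-(s * x))) (F' := fun x s => -(s * Real.exp (-(s * x))))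
    (bound := fun _ => Real.exp (|u| + 1)) (Metric.ball_mem_nhds u one_pos)
    (Eventually.of_forall fun x => (by fun_prop : Continuous _).aestronglyMeasurable)
    ((by fun_prop : Continuous fun s : ℝ => Real.exp (-(s * u))).intervalIntegrable _ _)
    ((by fun_prop : Continuous _).aestronglyMeasurable) ?_ (by simp) ?_
  · have h2 := h.2
    simp only [intervalIntegral.integral_neg] at h2
    exact h2
  · refine Eventually.of_forall fun s hs x hx => ?_
    rw [Set.uIoc_of_le zero_le_one] at hs
    rw [norm_neg, norm_mul, Real.norm_eq_abs, abs_of_pos hs.1, Real.norm_eq_abs, Real.abs_exp]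
    have hx' : |x - u| < 1 := by simpa [Real.dist_eq] using hx
    have hxb : -(s * x) ≤ |u| + 1 := by
      have h1 : |x| ≤ |u| + 1 := by
        have := abs_sub_abs_le_abs_sub x u; linarith
      have h2 : -(s * x) ≤ s * |x| := by
        have := neg_abs_le x
        nlinarith [hs.1]
      nlinarith [hs.1, hs.2, abs_nonneg x]
    have := Real.exp_le_exp.2 hxb
    nlinarith [hs.1, hs.2, Real.exp_pos (-(s * x))]
  · refine Eventually.of_forall fun s hs x hx => ?_
    exact hasDerivAt_exp_neg_mul s x

lemma mul_expMean (u : ℝ) : u * expMean u = 1 - Real.exp (-u) := by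
  have h : ∀ s ∈ Set.uIcc (0 : ℝ) 1,
      HasDerivAt (fun s : ℝ => -Real.exp (-(u * s))) (u * Real.exp (-(u * s))) s := fun s _ =>
    (hasDerivAt_exp_neg_mul u s).fun_neg.congr_deriv (neg_neg _)
  have := intervalIntegral.integral_eq_sub_of_hasDerivAt h
    ((by fun_prop : Continuous fun s : ℝ => u * Real.exp (-(u * s))).intervalIntegrable _ _)
  rw [intervalIntegral.integral_const_mul] at this
  simp only [expMean, mul_comm _ u]
  rw [this]
  simp
  ring

/-- Differentiating u · `expMean` u = 1 - exp(-u) gives this without a second integration by parts.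
-/
lemma mul_expMoment (u : ℝ) : u * expMoment u = expMean u - Real.exp (-u) := by
  have h1 := (hasDerivAt_id u).mul (hasDerivAt_expMean u)
  have h2 : HasDerivAt (fun u : ℝ => 1 - Real.exp (-u)) (Real.exp (-u)) u := by
    simpa using (hasDerivAt_exp_neg_mul 1 u).const_sub 1
  have h3 : (id * expMean) = fun u : ℝ => 1 - Real.exp (-u) := by
    ext v; simpa using mul_expMean v
  rw [h3] at h1
  have := h1.unique h2
  simp only [id] at this
  linarith

lemma expMean_zero : expMean 0 = 1 := by simp [expMean]

lemma expMean_nonneg (u : ℝ) : 0 ≤ expMean u :=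
  intervalIntegral.integral_nonneg zero_le_one fun _ _ => (Real.exp_pos _).le

lemma expMoment_nonneg (u : ℝ) : 0 ≤ expMoment u :=
  intervalIntegral.integral_nonneg zero_le_one fun _ hs => mul_nonneg hs.1 (Real.exp_pos _).le

lemma expMean_le_one {u : ℝ} (hu : 0 ≤ u) : expMean u ≤ 1 := by
  have h : expMean u ≤ ∫ _ in (0 : ℝ)..1, (1 : ℝ) :=
    intervalIntegral.integral_mono_on zero_le_one
      ((by fun_prop : Continuous fun s : ℝ => Real.exp (-(s * u))).intervalIntegrable _ _)
      (by simp) fun s hs => Real.exp_le_one_iff.2 (by nlinarith [hs.1])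
  simpa using h

lemma expMoment_le_one {u : ℝ} (hu : 0 ≤ u) : expMoment u ≤ 1 := by
  refine le_trans ?_ (expMean_le_one hu)
  exact intervalIntegral.integral_mono_on zero_le_one
    ((by fun_prop : Continuous fun s : ℝ => s * Real.exp (-(s * u))).intervalIntegrable _ _)
    ((by fun_prop : Continuous fun s : ℝ => Real.exp (-(s * u))).intervalIntegrable _ _)
    fun s hs => by nlinarith [hs.2, Real.exp_pos (-(s * u))]

lemma tendsto_expMean : Tendsto expMean atTop (𝓝 0) := by
  refine squeeze_zero' (Eventually.of_forall expMean_nonneg) ?_ tendsto_inv_atTop_zero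
  filter_upwards [eventually_gt_atTop 0] with u hu
  rw [← one_div, le_div_iff₀ hu, mul_comm, mul_expMean]
  linarith [Real.exp_pos (-u)]

lemma exp_mul_expMoment (u : ℝ) :
    Real.exp u * expMoment u = ∫ s in (0 : ℝ)..1, s * Real.exp ((1 - s) * u) := by
  rw [expMoment, ← intervalIntegral.integral_const_mul]
  congr 1
  ext s
  rw [mul_left_comm, ← Real.exp_add]
  ring_nf

/-- The sign of `expMoment u - 2 exp (-u)` changes exactly once on `[0, ∞)`. -/
lemma exists_sign_change_expMoment : ∃ u₀ : ℝ, 0 ≤ u₀ ∧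
    (∀ u, 0 ≤ u → u ≤ u₀ → expMoment u - 2 * Real.exp (-u) ≤ 0) ∧
    (∀ u, u₀ ≤ u → 0 ≤ expMoment u - 2 * Real.exp (-u)) := by
  -- Multiplying by exp u turns the sign question into a comparison of B with 2, and B averages the
  -- increasing functions s · exp((1 - s)u).
  set B : ℝ → ℝ := fun u => Real.exp u * expMoment u with hB
  have hmono : Monotone B := by
    intro u v huv
    simp only [hB, exp_mul_expMoment]
    refine intervalIntegral.integral_mono_on zero_le_one
      ((by fun_prop : Continuous fun s : ℝ => s * Real.exp ((1 - s) * u)).intervalIntegrable _ _)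
      ((by fun_prop : Continuous fun s : ℝ => s * Real.exp ((1 - s) * v)).intervalIntegrable _ _)
      fun s hs => ?_
    have : (1 - s) * u ≤ (1 - s) * v := mul_le_mul_of_nonneg_left huv (by linarith [hs.2])
    exact mul_le_mul_of_nonneg_left (Real.exp_le_exp.2 this) hs.1
  have hcont : Continuous B := by
    have : B = fun u => ∫ s in (0 : ℝ)..1, s * Real.exp ((1 - s) * u) :=
      funext exp_mul_expMoment
    rw [this]
    exact intervalIntegral.continuous_parametric_intervalIntegral_of_continuous'
      (by fun_prop) 0 1
  have h0 : B 0 ≤ 2 := by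
    simp only [hB, Real.exp_zero, one_mul]
    linarith [expMoment_le_one le_rfl]
  have h4 : 2 ≤ B 4 := by
    have e1 := mul_expMoment 4
    have e2 := mul_expMean 4
    have e3 : (37 : ℝ) ≤ Real.exp 4 := by
      have h := Real.exp_one_gt_d9
      have : Real.exp 4 = Real.exp 1 ^ 4 := by rw [← Real.exp_nat_mul]; norm_num
      rw [this]
      calc (37 : ℝ) ≤ 2.7182818283 ^ 4 := by norm_num
        _ ≤ _ := pow_le_pow_left₀ (by norm_num) h.le 4
    have e4 : Real.exp 4 * Real.exp (-4) = 1 := by rw [← Real.exp_add]; simp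
    have : 16 * B 4 = Real.exp 4 - 5 * (Real.exp 4 * Real.exp (-4)) := by
      simp only [hB]
      linear_combination Real.exp 4 * (4 * e1 + e2)
    rw [e4] at this
    linarith
  obtain ⟨u₀, hu₀, hBu⟩ := intermediate_value_Icc (by norm_num : (0 : ℝ) ≤ 4)
    hcont.continuousOn ⟨h0, h4⟩
  have key : ∀ u, expMoment u - 2 * Real.exp (-u) = Real.exp (-u) * (B u - 2) := by
    intro u
    simp only [hB]
    rw [mul_sub, ← mul_assoc, ← Real.exp_add]
    simp
    ring
  refine ⟨u₀, hu₀.1, fun u _ hu => ?_, fun u hu => ?_⟩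
  · rw [key]
    have := hmono hu
    exact mul_nonpos_of_nonneg_of_nonpos (Real.exp_pos _).le (by linarith)
  · rw [key]
    have := hmono hu
    exact mul_nonneg (Real.exp_pos _).le (by linarith)

lemma cubic_le_exp (x : ℝ) : 1 + x + x ^ 2 / 2 + x ^ 3 / 6 ≤ Real.exp x := by
  rcases le_total 0 x with hx | hx
  · have := Real.sum_le_exp_of_nonneg hx 4
    simp [Finset.sum_range_succ, Nat.factorial] at this
    linarith
  · have hexp : ∀ y : ℝ, HasDerivAt (fun y : ℝ => Real.exp (-y)) (-Real.exp (-y)) y := fun y => by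
      simpa using hasDerivAt_exp_neg_mul 1 y
    have hquad : ∀ y : ℝ, 0 ≤ y → Real.exp (-y) ≤ 1 - y + y ^ 2 / 2 := by
      have hm : MonotoneOn (fun y : ℝ => 1 - y + y ^ 2 / 2 - Real.exp (-y)) (Set.Ici 0) := by
        refine monotoneOn_of_hasDerivWithinAt_nonneg
          (f' := fun y => -1 + y + Real.exp (-y)) (convex_Ici 0) (by fun_prop)
          (fun y _ => ?_) fun y _ => ?_
        · refine HasDerivAt.hasDerivWithinAt ?_
          exact ((((hasDerivAt_id' y).const_sub 1).add ((hasDerivAt_pow 2 y).div_const 2)).sub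
            (hexp y)).congr_deriv (by norm_num)
        · linarith [Real.add_one_le_exp (-y)]
      intro y hy
      have := hm (Set.mem_Ici.2 le_rfl) (Set.mem_Ici.2 hy) hy
      norm_num at this
      linarith
    have hm : MonotoneOn (fun y : ℝ => Real.exp (-y) - 1 + y - y ^ 2 / 2 + y ^ 3 / 6)
        (Set.Ici 0) := by
      refine monotoneOn_of_hasDerivWithinAt_nonneg
        (f' := fun y => 1 - y + y ^ 2 / 2 - Real.exp (-y)) (convex_Ici 0) (by fun_prop)
        (fun y _ => ?_) fun y hy => ?_
      · refine HasDerivAt.hasDerivWithinAt ?_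
        exact (((((hexp y).sub_const 1).add (hasDerivAt_id' y)).sub
          ((hasDerivAt_pow 2 y).div_const 2)).add
          ((hasDerivAt_pow 3 y).div_const 6)).congr_deriv (by norm_num; ring)
      · rw [interior_Ici] at hy
        linarith [hquad y (Set.mem_Ioi.1 hy).le]
    have := hm (Set.mem_Ici.2 le_rfl) (Set.mem_Ici.2 (neg_nonneg.2 hx)) (neg_nonneg.2 hx)
    norm_num at this
    nlinarith

lemma le_exp_neg_sixteen_fifths : (0.04076 : ℝ) ≤ Real.exp (-3.2) := by
  rw [Real.exp_neg]
  have h : Real.exp 3.2 ≤ 24.533 := by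
    refine le_of_pow_le_pow_left₀ (n := 5) (by norm_num) (by norm_num) ?_
    have h1 : Real.exp 3.2 ^ 5 = Real.exp 1 ^ 16 := by
      rw [← Real.exp_nat_mul, ← Real.exp_nat_mul]; norm_num
    rw [h1]
    calc Real.exp 1 ^ 16 ≤ 2.7182818286 ^ 16 :=
          pow_le_pow_left₀ (Real.exp_pos _).le Real.exp_one_lt_d9.le 16
      _ ≤ _ := by norm_num
  calc (0.04076 : ℝ) ≤ (24.533)⁻¹ := by norm_num
    _ ≤ _ := inv_anti₀ (Real.exp_pos _) h

/-- This is u times the bound `expMean` u - 2 exp(-u) ≤ 0.21875, which controls the minimum of f'.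
The left side is nearly maximal at u = 3.2, where the slack is only about 0.0005; hence a Taylor
expansion at 0 for small u and one at 3.2 for the middle range. -/
lemma one_sub_le_mul_exp_neg {u : ℝ} (hu : 0 ≤ u) :
    1 - 0.21875 * u ≤ (1 + 2 * u) * Real.exp (-u) := by
  rcases le_total u 1 with h1 | h1
  · have h := mul_le_mul_of_nonneg_left (cubic_le_exp (-u)) (by linarith : 0 ≤ 1 + 2 * u)
    refine le_trans ?_ h
    have h3 : 0 ≤ 1.21875 - 1.5 * u + 5 / 6 * u ^ 2 - 1 / 3 * u ^ 3 := by
      nlinarith [mul_nonneg hu (sub_nonneg.2 h1), mul_nonneg (sq_nonneg u) (sub_nonneg.2 h1),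
        sq_nonneg (u - 1)]
    nlinarith [mul_nonneg hu h3]
  rcases le_total 4.6 u with h2 | h2
  -- Here the left side is already negative, as 0.21875 · 4.6 > 1.
  · have : 0 ≤ (1 + 2 * u) * Real.exp (-u) := by positivity
    linarith
  obtain ⟨v, rfl⟩ : ∃ v, u = v + 3.2 := ⟨u - 3.2, by ring⟩
  have hv1 : 0 ≤ v + 2.2 := by linarith
  have hv2 : 0 ≤ 1.4 - v := by linarith
  have hc := cubic_le_exp (-v)
  have hpos : 0 ≤ 1 + -v + (-v) ^ 2 / 2 + (-v) ^ 3 / 6 := by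
    nlinarith [mul_nonneg hv1 hv2, mul_nonneg (sq_nonneg v) hv2, sq_nonneg (v - 1)]
  have he : Real.exp (-(v + 3.2)) = Real.exp (-3.2) * Real.exp (-v) := by
    rw [← Real.exp_add]; ring_nf
  have hle : 0.04076 * (1 + -v + (-v) ^ 2 / 2 + (-v) ^ 3 / 6) ≤ Real.exp (-(v + 3.2)) := by
    rw [he]
    exact mul_le_mul le_exp_neg_sixteen_fifths hc hpos (Real.exp_pos _).le
  have h := mul_le_mul_of_nonneg_left hle (by linarith : 0 ≤ 1 + 2 * (v + 3.2))
  refine le_trans ?_ h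
  -- The bracket is the coefficient of v² in the difference of the two sides; 0.02 v² suffices to
  -- absorb the small linear term.
  have hb : 0 ≤ 0.04076 * (1.7 - 0.7 / 3 * v - v ^ 2 / 3) - 0.02 := by
    nlinarith [mul_nonneg hv1 hv2]
  nlinarith [mul_nonneg (sq_nonneg v) hb, sq_nonneg (v - 0.034)]

lemma expMean_sub_le {u : ℝ} (hu : 0 ≤ u) : expMean u - 2 * Real.exp (-u) ≤ 0.21875 := by
  rcases hu.eq_or_lt with rfl | hu'
  · rw [expMean_zero]; norm_num
  · refine le_of_mul_le_mul_left ?_ hu'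
    have := mul_expMean u
    have := one_sub_le_mul_exp_neg hu
    linarith

/-! ### The Stein test function and its derivatives -/

/-- The Stein test function `w ↦ (1 - exp (-3w²/2)) / w`. -/
def steinFn (w : ℝ) : ℝ := 3 / 2 * w * expMean (3 / 2 * w ^ 2)

/-- The derivative of `steinFn`. -/
def steinDeriv (w : ℝ) : ℝ :=
  3 * Real.exp (-(3 / 2 * w ^ 2)) - 3 / 2 * expMean (3 / 2 * w ^ 2)

/-- The second derivative of `steinFn`. -/
def steinDeriv₂ (w : ℝ) : ℝ :=
  9 / 2 * w * (expMoment (3 / 2 * w ^ 2) - 2 * Real.exp (-(3 / 2 * w ^ 2)))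

lemma mul_steinFn (w : ℝ) : w * steinFn w = 1 - Real.exp (-(3 / 2 * w ^ 2)) := by
  rw [← mul_expMean, steinFn]; ring

lemma hasDerivAt_scaled_sq (w : ℝ) : HasDerivAt (fun w : ℝ => 3 / 2 * w ^ 2) (3 * w) w :=
  ((hasDerivAt_pow 2 w).const_mul (3 / 2)).congr_deriv (by norm_num; ring)

lemma hasDerivAt_expMean_sq (w : ℝ) : HasDerivAt (fun w : ℝ => expMean (3 / 2 * w ^ 2))
    (-expMoment (3 / 2 * w ^ 2) * (3 * w)) w :=
  HasDerivAt.comp (h₂ := expMean) w (hasDerivAt_expMean (3 / 2 * w ^ 2)) (hasDerivAt_scaled_sq w)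

lemma hasDerivAt_exp_neg_sq (w : ℝ) : HasDerivAt (fun w : ℝ => Real.exp (-(3 / 2 * w ^ 2)))
    (-(3 * w * Real.exp (-(3 / 2 * w ^ 2)))) w :=
  (hasDerivAt_scaled_sq w).fun_neg.exp.congr_deriv (by ring)

lemma hasDerivAt_steinFn (w : ℝ) : HasDerivAt steinFn (steinDeriv w) w := by
  refine (((hasDerivAt_id' w).const_mul (3 / 2)).mul (hasDerivAt_expMean_sq w)).congr_deriv ?_
  have := mul_expMoment (3 / 2 * w ^ 2)
  rw [steinDeriv]
  linear_combination (-3) * this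

lemma hasDerivAt_steinDeriv (w : ℝ) : HasDerivAt steinDeriv (steinDeriv₂ w) w := by
  refine (((hasDerivAt_exp_neg_sq w).const_mul 3).sub
    ((hasDerivAt_expMean_sq w).const_mul (3 / 2))).congr_deriv ?_
  rw [steinDeriv₂]
  ring

lemma continuous_steinFn : Continuous steinFn :=
  continuous_iff_continuousAt.2 fun u => (hasDerivAt_steinFn u).continuousAt

lemma continuous_steinDeriv : Continuous steinDeriv :=
  continuous_iff_continuousAt.2 fun u => (hasDerivAt_steinDeriv u).continuousAt

lemma abs_steinFn_le (w : ℝ) : |steinFn w| ≤ 3 / 2 := by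
  have h0 : 0 ≤ 3 / 2 * w ^ 2 := by positivity
  rcases le_total |w| 1 with h | h
  · rw [steinFn, abs_mul, abs_mul, abs_of_nonneg (expMean_nonneg _)]
    have := expMean_le_one h0
    have := expMean_nonneg (3 / 2 * w ^ 2)
    norm_num
    nlinarith [abs_nonneg w]
  · have h1 : |w| * |steinFn w| ≤ 1 := by
      rw [← abs_mul, mul_steinFn, abs_le]
      constructor <;> linarith [Real.exp_pos (-(3 / 2 * w ^ 2)),
        Real.exp_le_one_iff.2 (neg_nonpos.2 h0)]
    nlinarith [abs_nonneg (steinFn w)]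

lemma abs_steinDeriv_le (w : ℝ) : |steinDeriv w| ≤ 3 := by
  have h0 : 0 ≤ 3 / 2 * w ^ 2 := by positivity
  have := expMean_le_one h0
  have := expMean_nonneg (3 / 2 * w ^ 2)
  have := Real.exp_pos (-(3 / 2 * w ^ 2))
  have := Real.exp_le_one_iff.2 (neg_nonpos.2 h0)
  rw [steinDeriv, abs_le]
  constructor <;> linarith

/-- With |w| ≤ 1 + 2u/3, the bounds on `expMoment` u, u · `expMoment` u and (1 + u)exp(-u) give 9/2
· (1 + 2/3 + 2) = 16.5. The constant is not optimised: it only multiplies δ, which vanishes in the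
limit. -/
lemma abs_steinDeriv₂_le (w : ℝ) : |steinDeriv₂ w| ≤ 17 := by
  set u := 3 / 2 * w ^ 2 with hu
  have h0 : 0 ≤ u := by positivity
  have h1 := expMoment_le_one h0
  have h2 := expMoment_nonneg u
  have h3 : u * expMoment u ≤ 1 := by
    rw [mul_expMoment]
    linarith [expMean_le_one h0, Real.exp_pos (-u)]
  have h4 := Real.exp_pos (-u)
  have h5 : (1 + u) * Real.exp (-u) ≤ 1 := by
    have := mul_le_mul_of_nonneg_right (Real.add_one_le_exp u) h4.le
    rw [← Real.exp_add] at this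
    simp at this
    linarith
  have hw : |w| ≤ 1 + 2 / 3 * u := by
    rw [hu]
    nlinarith [sq_abs w, sq_nonneg (|w| - 1)]
  have hd : |expMoment u - 2 * Real.exp (-u)| ≤ expMoment u + 2 * Real.exp (-u) := by
    rw [abs_le]; constructor <;> linarith
  have : |steinDeriv₂ w| = 9 / 2 * (|w| * |expMoment u - 2 * Real.exp (-u)|) := by
    rw [steinDeriv₂, abs_mul, abs_mul, ← hu]; norm_num; ring
  rw [this]
  have := mul_le_mul hw hd (abs_nonneg _) (by positivity)
  nlinarith

lemma tendsto_scaled_sq_atTop : Tendsto (fun w : ℝ => 3 / 2 * w ^ 2) atTop atTop :=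
  (tendsto_pow_atTop two_ne_zero).const_mul_atTop (by norm_num)

lemma tendsto_exp_neg_sq : Tendsto (fun w : ℝ => Real.exp (-(3 / 2 * w ^ 2))) atTop (𝓝 0) :=
  Real.tendsto_exp_neg_atTop_nhds_zero.comp tendsto_scaled_sq_atTop

lemma tendsto_steinDeriv : Tendsto steinDeriv atTop (𝓝 0) := by
  rw [show (0 : ℝ) = 3 * 0 - 3 / 2 * 0 by norm_num]
  exact (tendsto_exp_neg_sq.const_mul 3).sub
    ((tendsto_expMean.comp tendsto_scaled_sq_atTop).const_mul (3 / 2))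

/-! ### Distribution functions and total variation -/

/-- If the distribution functions of `μ` and `ν` differ by at most `κ`, the integrals of a function
differ by at most `κ` times its total variation. -/
lemma abs_integral_sub_le_of_cdf {μ ν : Measure ℝ} [IsProbabilityMeasure μ]
    [IsProbabilityMeasure ν] {κ l : ℝ}
    (hκ : ∀ t, |μ.real (Set.Iic t) - ν.real (Set.Iic t)| ≤ κ) {q q' : ℝ → ℝ}
    (hq : ∀ t, HasDerivAt q (q' t) t) (hq' : Integrable q') (hl : Tendsto q atTop (𝓝 l)) :
    |∫ w, q w ∂μ - ∫ w, q w ∂ν| ≤ κ * ∫ t, |q' t| := by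
  -- Writing q as its limit at +∞ minus the integral of q' over t ≥ w lets Fubini express each
  -- integral through the distribution function.
  have hrepr : ∀ w, q w = l - ∫ t, (Set.Iic t).indicator (fun _ => q' t) w := by
    intro w
    have h := integral_Ioi_of_hasDerivAt_of_tendsto (a := w) (hq w).continuousAt.continuousWithinAt
      (fun x _ => hq x) hq'.integrableOn hl
    have h2 : ∫ t, (Set.Iic t).indicator (fun _ => q' t) w = ∫ t in Set.Ioi w, q' t := by
      rw [← integral_Ici_eq_integral_Ioi, ← integral_indicator measurableSet_Ici]
      refine integral_congr_ae (Eventually.of_forall fun t => ?_)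
      simp [Set.indicator]
    rw [h2, h]
    ring
  have hm : MeasurableSet {p : ℝ × ℝ | p.1 ≤ p.2} :=
    measurableSet_le measurable_fst measurable_snd
  have key : ∀ (ρ : Measure ℝ) [IsProbabilityMeasure ρ],
      Integrable (fun t => q' t * ρ.real (Set.Iic t)) ∧
      ∫ w, q w ∂ρ = l - ∫ t, q' t * ρ.real (Set.Iic t) := by
    intro ρ _
    have hint : Integrable (Function.uncurry fun (w t : ℝ) =>
        (Set.Iic t).indicator (fun _ => q' t) w) (ρ.prod volume) := by
      have h1 : Integrable (fun p : ℝ × ℝ => q' p.2) (ρ.prod volume) := hq'.comp_snd ρ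
      refine (h1.indicator hm).congr (Eventually.of_forall fun p => ?_)
      simp [Set.indicator, Function.uncurry]
    have h3 : ∀ t, ∫ w, (Set.Iic t).indicator (fun _ => q' t) w ∂ρ = q' t * ρ.real (Set.Iic t) := by
      intro t
      rw [integral_indicator_const _ measurableSet_Iic, smul_eq_mul, mul_comm]
    constructor
    · have := hint.integral_prod_right
      simpa only [Function.uncurry, h3] using this
    · have hs := integral_integral_swap hint
      simp only [h3] at hs
      have hi := hint.integral_prod_left
      simp only [Function.uncurry] at hi
      rw [← hs, ← integral_congr_ae (Eventually.of_forall fun w => (hrepr w).symm),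
        integral_sub (integrable_const _) hi]
      simp
  rw [(key μ).2, (key ν).2, sub_sub_sub_cancel_left, ← integral_sub (key ν).1 (key μ).1,
    ← integral_const_mul]
  refine (abs_integral_le_integral_abs).trans (integral_mono_of_nonneg
    (Eventually.of_forall fun _ => abs_nonneg _) (hq'.abs.const_mul κ)
    (Eventually.of_forall fun t => ?_))
  simp only
  rw [← mul_sub, abs_mul, abs_sub_comm, mul_comm]
  exact mul_le_mul_of_nonneg_right (hκ t) (abs_nonneg _)

lemma integrable_of_abs_even {g : ℝ → ℝ} (hg : ∀ x, |g x| = |g (|x|)|) (hm : Continuous g)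
    (hi : IntegrableOn g (Set.Ioi 0)) : Integrable g := by
  have hneg : ∀ x, |g (-x)| = |g x| := fun x => by rw [hg, hg x, abs_neg]
  rw [← integrableOn_univ, ← Set.Iic_union_Ioi (a := (0 : ℝ))]
  refine IntegrableOn.union ?_ hi
  have h1 : IntegrableOn (fun x => g (-x)) (Set.Iic 0) := by
    have := Iff.mpr integrableOn_Ici_iff_integrableOn_Ioi hi
    rw [← Measure.map_neg_eq_self (volume : Measure ℝ)]
    have m : MeasurableEmbedding fun x : ℝ => -x := (Homeomorph.neg ℝ).measurableEmbedding
    rw [m.integrableOn_map_iff]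
    simpa [Function.comp_def] using this
  exact h1.congr' hm.aestronglyMeasurable (Eventually.of_forall fun x => hneg x)

lemma integral_abs_of_abs_even {g : ℝ → ℝ} (hg : ∀ x, |g x| = |g (|x|)|) :
    ∫ x, |g x| = 2 * ∫ x in Set.Ioi 0, |g x| := by
  rw [← integral_comp_abs (f := fun x => |g x|)]
  exact integral_congr_ae (Eventually.of_forall hg)

lemma integrableOn_deriv_one_sub_exp_neg_sq :
    IntegrableOn (fun w : ℝ => 3 * w * Real.exp (-(3 / 2 * w ^ 2))) (Set.Ioi 0) ∧
    ∫ w in Set.Ioi (0 : ℝ), 3 * w * Real.exp (-(3 / 2 * w ^ 2)) = 1 := by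
  have hd : ∀ w : ℝ, HasDerivAt (fun w : ℝ => 1 - Real.exp (-(3 / 2 * w ^ 2)))
      (3 * w * Real.exp (-(3 / 2 * w ^ 2))) w := fun w =>
    ((hasDerivAt_exp_neg_sq w).const_sub 1).congr_deriv (neg_neg _)
  have ht : Tendsto (fun w : ℝ => 1 - Real.exp (-(3 / 2 * w ^ 2))) atTop (𝓝 1) := by
    simpa using tendsto_exp_neg_sq.const_sub 1
  have hp : ∀ w ∈ Set.Ioi (0 : ℝ), 0 ≤ 3 * w * Real.exp (-(3 / 2 * w ^ 2)) := fun w hw => by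
    have := Set.mem_Ioi.1 hw
    positivity
  refine ⟨integrableOn_Ioi_deriv_of_nonneg (hd 0).continuousAt.continuousWithinAt
    (fun x _ => hd x) hp ht, ?_⟩
  rw [integral_Ioi_of_hasDerivAt_of_nonneg (hd 0).continuousAt.continuousWithinAt
    (fun x _ => hd x) hp ht]
  simp

/-- The function `w ↦ w * steinFn w` has total variation `2`. -/
lemma abs_integral_mul_steinFn_sub_le {μ ν : Measure ℝ} [IsProbabilityMeasure μ]
    [IsProbabilityMeasure ν] {κ : ℝ}
    (hκ : ∀ t, |μ.real (Set.Iic t) - ν.real (Set.Iic t)| ≤ κ) :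
    |∫ w, w * steinFn w ∂μ - ∫ w, w * steinFn w ∂ν| ≤ 2 * κ := by
  have hd : ∀ w : ℝ, HasDerivAt (fun w => w * steinFn w)
      (3 * w * Real.exp (-(3 / 2 * w ^ 2))) w := fun w => by
    simp only [mul_steinFn]
    exact ((hasDerivAt_exp_neg_sq w).const_sub 1).congr_deriv (neg_neg _)
  have ht : Tendsto (fun w => w * steinFn w) atTop (𝓝 1) := by
    simp only [mul_steinFn]
    simpa using tendsto_exp_neg_sq.const_sub 1
  have he : ∀ w : ℝ, |3 * w * Real.exp (-(3 / 2 * w ^ 2))| =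
      |3 * |w| * Real.exp (-(3 / 2 * |w| ^ 2))| := fun w => by simp [abs_mul]
  obtain ⟨h1, h2⟩ := integrableOn_deriv_one_sub_exp_neg_sq
  refine (abs_integral_sub_le_of_cdf hκ hd
    (integrable_of_abs_even he (by fun_prop) h1) ht).trans (le_of_eq ?_)
  rw [integral_abs_of_abs_even he, setIntegral_congr_fun measurableSet_Ioi (g := fun w =>
    3 * w * Real.exp (-(3 / 2 * w ^ 2))), h2]
  · ring
  · intro w hw
    have := Set.mem_Ioi.1 hw
    exact abs_of_nonneg (by positivity)

lemma continuous_steinDeriv₂ : Continuous steinDeriv₂ := by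
  have h : Continuous expMoment := by
    unfold expMoment
    exact intervalIntegral.continuous_parametric_intervalIntegral_of_continuous' (by fun_prop) 0 1
  unfold steinDeriv₂
  fun_prop

/-- The total variation of `steinDeriv` is at most `3 + 6 * 0.21875`. -/
lemma integrable_steinDeriv₂ : Integrable steinDeriv₂ ∧ ∫ w, |steinDeriv₂ w| ≤ 4.3125 := by
  obtain ⟨u₀, hu₀, hneg, hpos⟩ := exists_sign_change_expMoment
  -- On [0, ∞), f' falls from 3/2 to its minimum at w₀ and then rises to 0. The variation over the
  -- line is therefore 2(3/2 - 2f'(w₀)), with -f'(w₀) ≤ 3/2 · 0.21875.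
  set w₀ := √(2 / 3 * u₀) with hw₀
  have hw₀0 : 0 ≤ w₀ := Real.sqrt_nonneg _
  have hsq : 3 / 2 * w₀ ^ 2 = u₀ := by
    rw [hw₀, Real.sq_sqrt (by positivity)]; ring
  have hnp : ∀ w ∈ Set.Icc 0 w₀, steinDeriv₂ w ≤ 0 := fun w hw => by
    refine mul_nonpos_of_nonneg_of_nonpos (by linarith [hw.1]) (hneg _ (by positivity) ?_)
    rw [← hsq]
    have := pow_le_pow_left₀ hw.1 hw.2 2
    linarith
  have hnn : ∀ w ∈ Set.Ioi w₀, 0 ≤ steinDeriv₂ w := fun w hw => by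
    have hw' := Set.mem_Ioi.1 hw
    refine mul_nonneg (by linarith) (hpos _ ?_)
    rw [← hsq]
    have := pow_le_pow_left₀ hw₀0 hw'.le 2
    linarith
  have he : ∀ w : ℝ, |steinDeriv₂ w| = |steinDeriv₂ (|w|)| := fun w => by
    simp [steinDeriv₂, abs_mul]
  have hc := hasDerivAt_steinDeriv
  have hi2 : IntegrableOn steinDeriv₂ (Set.Ioi w₀) :=
    integrableOn_Ioi_deriv_of_nonneg (hc w₀).continuousAt.continuousWithinAt
      (fun x _ => hc x) hnn tendsto_steinDeriv
  have hi1 : IntegrableOn steinDeriv₂ (Set.Ioc 0 w₀) :=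
    (continuous_steinDeriv₂.integrableOn_Icc).mono_set Set.Ioc_subset_Icc_self
  have hI : IntegrableOn steinDeriv₂ (Set.Ioi 0) := by
    rw [← Set.Ioc_union_Ioi_eq_Ioi hw₀0]
    exact hi1.union hi2
  refine ⟨integrable_of_abs_even he continuous_steinDeriv₂ hI, ?_⟩
  have hs2 : ∫ w in Set.Ioi w₀, |steinDeriv₂ w| = -steinDeriv w₀ := by
    rw [setIntegral_congr_fun measurableSet_Ioi (g := steinDeriv₂)
        (fun w hw => abs_of_nonneg (hnn w hw)),
      integral_Ioi_of_hasDerivAt_of_nonneg (hc w₀).continuousAt.continuousWithinAt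
      (fun x _ => hc x) hnn tendsto_steinDeriv, zero_sub]
  have hs1 : ∫ w in Set.Ioc 0 w₀, |steinDeriv₂ w| = steinDeriv 0 - steinDeriv w₀ := by
    rw [setIntegral_congr_fun measurableSet_Ioc (g := fun w => -steinDeriv₂ w)
        (fun w hw => abs_of_nonpos (hnp w (Set.Ioc_subset_Icc_self hw))),
      integral_neg, ← intervalIntegral.integral_of_le hw₀0,
      intervalIntegral.integral_eq_sub_of_hasDerivAt (fun x _ => hc x)
        (continuous_steinDeriv₂.intervalIntegrable _ _), neg_sub]
  rw [integral_abs_of_abs_even he, ← Set.Ioc_union_Ioi_eq_Ioi hw₀0,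
    setIntegral_union (Set.Ioc_disjoint_Ioi le_rfl) measurableSet_Ioi hi1.abs hi2.abs, hs1, hs2]
  have h0 : steinDeriv 0 = 3 / 2 := by simp [steinDeriv, expMean_zero]; norm_num
  have hm := expMean_sub_le hu₀
  have hw : steinDeriv w₀ = 3 * Real.exp (-u₀) - 3 / 2 * expMean u₀ := by
    rw [steinDeriv, hsq]
  rw [h0, hw]
  linarith

lemma abs_integral_steinDeriv_add_sub_le {μ ν : Measure ℝ} [IsProbabilityMeasure μ]
    [IsProbabilityMeasure ν] {κ : ℝ}
    (hκ : ∀ t, |μ.real (Set.Iic t) - ν.real (Set.Iic t)| ≤ κ) (x : ℝ) :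
    |∫ w, steinDeriv (w + x) ∂μ - ∫ w, steinDeriv (w + x) ∂ν| ≤ 4.3125 * κ := by
  have hκ0 : 0 ≤ κ := (abs_nonneg _).trans (hκ 0)
  refine (abs_integral_sub_le_of_cdf hκ (q := fun w => steinDeriv (w + x))
    (fun w => (hasDerivAt_steinDeriv (w + x)).comp_add_const w x)
    (integrable_steinDeriv₂.1.comp_add_right x)
    (tendsto_steinDeriv.comp (tendsto_atTop_add_const_right _ x tendsto_id))).trans ?_
  rw [integral_add_right_eq_self (fun w => |steinDeriv₂ w|), mul_comm]
  exact mul_le_mul_of_nonneg_right integrable_steinDeriv₂.2 hκ0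

/-! ### Gaussian averages of the test function -/

lemma integral_gaussianReal_eq (h : ℝ → ℝ) :
    ∫ z, h z ∂gaussianReal 0 1 = (√(2 * Real.pi))⁻¹ * ∫ z, Real.exp (-z ^ 2 / 2) * h z := by
  rw [integral_gaussianReal_eq_integral_smul one_ne_zero, ← integral_const_mul]
  refine integral_congr_ae (Eventually.of_forall fun z => ?_)
  simp [gaussianPDFReal, mul_assoc]

lemma integral_id_mul_exp_neg_mul_sq (b : ℝ) : ∫ v : ℝ, v * Real.exp (-b * v ^ 2) = 0 := by
  have h := integral_neg_eq_self (fun v : ℝ => v * Real.exp (-b * v ^ 2)) volume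
  simp only [neg_sq, neg_mul (α := ℝ), integral_neg] at h
  simp only [neg_mul (α := ℝ)]
  linarith

lemma inv_sqrt_two_pi_mul_sqrt {c : ℝ} (hc : 0 < c) :
    (√(2 * Real.pi))⁻¹ * √(Real.pi / (c / 2)) = (√c)⁻¹ := by
  have h : Real.pi / (c / 2) = 2 * Real.pi / c := by field_simp
  have h2 : 0 < √(2 * Real.pi) := Real.sqrt_pos.2 (by positivity)
  rw [h, Real.sqrt_div (by positivity)]
  field_simp

lemma integral_exp_neg_sq_gaussianReal :
    ∫ z, Real.exp (-(3 / 2 * z ^ 2)) ∂gaussianReal 0 1 = 1 / 2 := by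
  rw [integral_gaussianReal_eq]
  have h : ∀ z : ℝ, Real.exp (-z ^ 2 / 2) * Real.exp (-(3 / 2 * z ^ 2)) =
      Real.exp (-(4 / 2) * z ^ 2) := fun z => by
    rw [← Real.exp_add]; ring_nf
  simp only [h]
  rw [integral_gaussian, inv_sqrt_two_pi_mul_sqrt (by norm_num),
    show (4 : ℝ) = 2 ^ 2 by norm_num, Real.sqrt_sq (by norm_num)]
  norm_num

lemma integral_mul_steinFn_gaussianReal :
    ∫ z, z * steinFn z ∂gaussianReal 0 1 = 1 / 2 := by
  simp only [mul_steinFn]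
  have hi : Integrable (fun z : ℝ => Real.exp (-(3 / 2 * z ^ 2))) (gaussianReal 0 1) := by
    refine Integrable.of_bound (by fun_prop : Continuous _).aestronglyMeasurable 1
      (Eventually.of_forall fun z => ?_)
    rw [Real.norm_eq_abs, Real.abs_exp, Real.exp_le_one_iff]
    nlinarith [sq_nonneg z]
  rw [integral_sub (integrable_const _) hi, integral_exp_neg_sq_gaussianReal]
  norm_num

/-- Completing the square leaves a Gaussian weight of precision c = 1 + 3s centred at -3sx/c; the
odd part integrates to zero. -/
lemma integral_shift_mul_exp_gaussianReal {s : ℝ} (hs : 0 ≤ s) (x : ℝ) :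
    ∫ z, (z + x) * Real.exp (-(s * (3 / 2 * (z + x) ^ 2))) ∂gaussianReal 0 1 =
      x * ((√(1 + 3 * s))⁻¹ ^ 3 * Real.exp (-(3 * s / (1 + 3 * s) * (x ^ 2 / 2)))) := by
  have hc : 0 < 1 + 3 * s := by linarith
  rw [integral_gaussianReal_eq]
  set c := 1 + 3 * s with hcdef
  set E := Real.exp (-(3 * s / c * (x ^ 2 / 2))) with hE
  have h : ∀ z : ℝ, Real.exp (-z ^ 2 / 2) * ((z + x) * Real.exp (-(s * (3 / 2 * (z + x) ^ 2)))) =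
      (fun v => E * (v * Real.exp (-(c / 2) * v ^ 2)) + E * (x / c) * Real.exp (-(c / 2) * v ^ 2))
        (z + 3 * s * x / c) := by
    intro z
    have h1 : Real.exp (-z ^ 2 / 2) * Real.exp (-(s * (3 / 2 * (z + x) ^ 2))) =
        E * Real.exp (-(c / 2) * (z + 3 * s * x / c) ^ 2) := by
      rw [hE, ← Real.exp_add, ← Real.exp_add]
      congr 1
      field_simp
      rw [hcdef]
      ring
    have h2 : z + x = (z + 3 * s * x / c) + x / c := by
      field_simp
      rw [hcdef]
      ring
    simp only
    rw [mul_left_comm, h1]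
    nth_rewrite 1 [h2]
    ring
  simp only [h]
  have hi1 := (integrable_mul_exp_neg_mul_sq (by positivity : 0 < c / 2)).const_mul E
  have hi2 := (integrable_exp_neg_mul_sq (by positivity : 0 < c / 2)).const_mul (E * (x / c))
  rw [integral_add_right_eq_self (fun v => E * (v * Real.exp (-(c / 2) * v ^ 2)) +
    E * (x / c) * Real.exp (-(c / 2) * v ^ 2)), integral_add hi1 hi2, integral_const_mul,
    integral_const_mul, integral_id_mul_exp_neg_mul_sq, integral_gaussian, mul_zero, zero_add,
    mul_left_comm, inv_sqrt_two_pi_mul_sqrt hc]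
  have h3 : c⁻¹ = (√c)⁻¹ ^ 2 := by rw [inv_pow, Real.sq_sqrt hc.le]
  rw [div_eq_mul_inv, h3]
  ring

/-- f is a mixture over s ∈ [0, 1] of the functions (3/2)w exp(-3sw²/2), so Fubini reduces its
Gaussian average to the explicit shifted integrals. -/
lemma integral_steinFn_add_gaussianReal (x : ℝ) :
    ∫ z, steinFn (z + x) ∂gaussianReal 0 1 = x * ∫ s in (0 : ℝ)..1,
      3 / 2 * ((√(1 + 3 * s))⁻¹ ^ 3 * Real.exp (-(3 * s / (1 + 3 * s) * (x ^ 2 / 2)))) := by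
  have h1 : ∀ z, steinFn (z + x) = ∫ s in Set.Ioc (0 : ℝ) 1,
      3 / 2 * ((z + x) * Real.exp (-(s * (3 / 2 * (z + x) ^ 2)))) := by
    intro z
    rw [steinFn, expMean, intervalIntegral.integral_of_le zero_le_one, ← integral_const_mul]
    simp only [mul_assoc]
  simp only [h1]
  have hint : Integrable (Function.uncurry fun (z s : ℝ) =>
      3 / 2 * ((z + x) * Real.exp (-(s * (3 / 2 * (z + x) ^ 2)))))
      ((gaussianReal 0 1).prod (volume.restrict (Set.Ioc (0 : ℝ) 1))) := by
    have hz : Integrable (fun z : ℝ => 3 / 2 * (z + x)) (gaussianReal 0 1) :=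
      (((memLp_id_gaussianReal 1).integrable (by norm_num)).add (integrable_const x)).const_mul _
    have hb := hz.comp_fst (volume.restrict (Set.Ioc (0 : ℝ) 1))
    have hs : ∀ᵐ p : ℝ × ℝ ∂((gaussianReal 0 1).prod (volume.restrict (Set.Ioc (0 : ℝ) 1))),
        p.2 ∈ Set.Ioc (0 : ℝ) 1 :=
      Measure.quasiMeasurePreserving_snd.ae (ae_restrict_mem measurableSet_Ioc)
    refine hb.mono ((by fun_prop : Continuous fun p : ℝ × ℝ => 3 / 2 * ((p.1 + x) *
      Real.exp (-(p.2 * (3 / 2 * (p.1 + x) ^ 2))))).aestronglyMeasurable) ?_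
    filter_upwards [hs] with p hp
    have : Real.exp (-(p.2 * (3 / 2 * (p.1 + x) ^ 2))) ≤ 1 := by
      rw [Real.exp_le_one_iff]
      have := hp.1.le
      have : 0 ≤ p.2 * (3 / 2 * (p.1 + x) ^ 2) := by positivity
      linarith
    rw [Function.uncurry, ← mul_assoc, norm_mul]
    refine mul_le_of_le_one_right (norm_nonneg _) ?_
    rwa [Real.norm_eq_abs, Real.abs_exp]
  rw [integral_integral_swap hint, ← intervalIntegral.integral_const_mul,
    intervalIntegral.integral_of_le zero_le_one]
  refine setIntegral_congr_fun measurableSet_Ioc fun s hs => ?_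
  rw [integral_const_mul, integral_shift_mul_exp_gaussianReal hs.1.le]
  ring

/-- The chord bound for the convex exponential. It turns every exponent θ = 3s/(1 + 3s) of the
mixture into the single weight 1 - exp(-y), with y = x²/2. -/
lemma exp_neg_mul_le {θ y : ℝ} (h0 : 0 ≤ θ) (h1 : θ ≤ 1) :
    Real.exp (-(θ * y)) ≤ 1 - θ * (1 - Real.exp (-y)) := by
  have := convexOn_exp.2 (Set.mem_univ (-y)) (Set.mem_univ 0) h0 (sub_nonneg.2 h1) (by ring)
  simp only [smul_eq_mul, mul_zero, add_zero, Real.exp_zero, mul_one] at this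
  rw [← mul_neg]
  linarith

lemma integral_mixing_weight (φ : ℝ) : ∫ s in (0 : ℝ)..1,
    3 / 2 * ((√(1 + 3 * s))⁻¹ ^ 3 * (1 - 3 * s / (1 + 3 * s) * φ)) = 1 / 2 - 5 / 24 * φ := by
  have hpos : ∀ s ∈ Set.uIcc (0 : ℝ) 1, 0 < 1 + 3 * s := fun s hs => by
    rw [Set.uIcc_of_le zero_le_one] at hs
    linarith [hs.1]
  have hr : ∀ s ∈ Set.uIcc (0 : ℝ) 1, HasDerivAt (fun s : ℝ => (√(1 + 3 * s))⁻¹)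
      (-(3 / 2) * (√(1 + 3 * s))⁻¹ ^ 3) s := fun s hs => by
    have h1 : HasDerivAt (fun s : ℝ => 1 + 3 * s) 3 s :=
      (((hasDerivAt_id' s).const_mul 3).const_add 1).congr_deriv (by norm_num)
    have hp := hpos s hs
    have hp' := Real.sqrt_pos.2 hp
    refine ((h1.sqrt hp.ne').fun_inv hp'.ne').congr_deriv ?_
    field_simp
  -- In r = (1 + 3s)^(-1/2) the integrand is polynomial times dr, since 3s/(1 + 3s) = 1 - r². As s
  -- runs over [0, 1], r goes from 1 to 1/2, which produces 1/2 and 5/24.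
  have hd : ∀ s ∈ Set.uIcc (0 : ℝ) 1, HasDerivAt
      (fun s : ℝ => -(1 - φ) * (√(1 + 3 * s))⁻¹ - φ / 3 * (√(1 + 3 * s))⁻¹ ^ 3)
      (3 / 2 * ((√(1 + 3 * s))⁻¹ ^ 3 * (1 - 3 * s / (1 + 3 * s) * φ))) s := fun s hs => by
    refine (((hr s hs).const_mul (-(1 - φ))).sub
      (((hr s hs).fun_pow 3).const_mul (φ / 3))).congr_deriv ?_
    have hp := hpos s hs
    have h1 : 3 * s / (1 + 3 * s) = 1 - (√(1 + 3 * s))⁻¹ ^ 2 := by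
      rw [inv_pow, Real.sq_sqrt hp.le]
      field_simp
      ring
    rw [h1]
    push_cast
    ring
  have hcont : ContinuousOn (fun s : ℝ =>
      3 / 2 * ((√(1 + 3 * s))⁻¹ ^ 3 * (1 - 3 * s / (1 + 3 * s) * φ))) (Set.uIcc 0 1) := by
    have hne : ∀ s ∈ Set.uIcc (0 : ℝ) 1, 1 + 3 * s ≠ 0 := fun s hs => (hpos s hs).ne'
    have hne' : ∀ s ∈ Set.uIcc (0 : ℝ) 1, √(1 + 3 * s) ≠ 0 := fun s hs =>
      (Real.sqrt_pos.2 (hpos s hs)).ne'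
    fun_prop (disch := assumption)
  rw [intervalIntegral.integral_eq_sub_of_hasDerivAt hd hcont.intervalIntegrable]
  have h4 : √(1 + 3 * 1) = 2 := by
    rw [show (1 + 3 * 1 : ℝ) = 2 ^ 2 by norm_num, Real.sqrt_sq (by norm_num)]
  rw [h4]
  norm_num
  ring

lemma mul_integral_steinFn_add_gaussianReal_le (x : ℝ) :
    x * ∫ z, steinFn (z + x) ∂gaussianReal 0 1 ≤
      x ^ 2 * (1 / 2 - 5 / 24 * (1 - Real.exp (-(x ^ 2 / 2)))) := by
  rw [integral_steinFn_add_gaussianReal, ← mul_assoc, ← sq, ← integral_mixing_weight]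
  refine mul_le_mul_of_nonneg_left ?_ (sq_nonneg x)
  have hne : ∀ s ∈ Set.uIcc (0 : ℝ) 1, 1 + 3 * s ≠ 0 := fun s hs => by
    rw [Set.uIcc_of_le zero_le_one] at hs
    linarith [hs.1]
  have hne' : ∀ s ∈ Set.uIcc (0 : ℝ) 1, √(1 + 3 * s) ≠ 0 := fun s hs => by
    rw [Set.uIcc_of_le zero_le_one] at hs
    exact (Real.sqrt_pos.2 (by linarith [hs.1])).ne'
  refine intervalIntegral.integral_mono_on zero_le_one
    (ContinuousOn.intervalIntegrable (by fun_prop (disch := assumption)))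
    (ContinuousOn.intervalIntegrable (by fun_prop (disch := assumption))) fun s hs => ?_
  have hp : 0 < 1 + 3 * s := by linarith [hs.1]
  gcongr
  refine exp_neg_mul_le (div_nonneg (by linarith [hs.1]) hp.le) ?_
  rw [div_le_one hp]
  linarith

lemma integral_steinFn_gaussianReal : ∫ z, steinFn z ∂gaussianReal 0 1 = 0 := by
  simpa using integral_steinFn_add_gaussianReal 0

/-! ### Comparing increments under two laws -/

lemma integrable_steinFn_add (μ : Measure ℝ) [IsProbabilityMeasure μ] (x : ℝ) :
    Integrable (fun w => steinFn (w + x)) μ :=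
  Integrable.of_bound (continuous_steinFn.comp (continuous_add_const x)).aestronglyMeasurable
    (3 / 2) (Eventually.of_forall fun _ => abs_steinFn_le _)

lemma hasDerivAt_integral_steinFn_add (μ : Measure ℝ) [IsProbabilityMeasure μ] (x : ℝ) :
    HasDerivAt (fun x => ∫ w, steinFn (w + x) ∂μ) (∫ w, steinDeriv (w + x) ∂μ) x :=
  (hasDerivAt_integral_of_dominated_loc_of_deriv_le (bound := fun _ => 3) (s := Set.univ)
    (F := fun x w => steinFn (w + x)) (F' := fun x w => steinDeriv (w + x)) univ_mem
    (Eventually.of_forall fun y => (integrable_steinFn_add μ y).aestronglyMeasurable)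
    (integrable_steinFn_add μ x)
    (continuous_steinDeriv.comp (continuous_add_const x)).aestronglyMeasurable
    (Eventually.of_forall fun _ _ _ => abs_steinDeriv_le _) (integrable_const _)
    (Eventually.of_forall fun w y _ => (hasDerivAt_steinFn (w + y)).comp_const_add w y)).2

/-- Mean value inequality for x ↦ E f(V + x) - E f(Z + x). The factor |x| matters: after
multiplication by X the error is proportional to the variance and sums to C over the row. -/
lemma abs_integral_steinFn_increment_sub_le {μ ν : Measure ℝ} [IsProbabilityMeasure μ]
    [IsProbabilityMeasure ν] {C : ℝ}
    (h : ∀ x, |∫ w, steinDeriv (w + x) ∂μ - ∫ w, steinDeriv (w + x) ∂ν| ≤ C) (x : ℝ) :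
    |(∫ w, steinFn (w + x) ∂μ - ∫ w, steinFn w ∂μ) -
      (∫ w, steinFn (w + x) ∂ν - ∫ w, steinFn w ∂ν)| ≤ C * |x| := by
  have := Convex.norm_image_sub_le_of_norm_hasDerivWithin_le (s := Set.univ) (x := 0) (y := x)
    (fun y _ => ((hasDerivAt_integral_steinFn_add μ y).sub
      (hasDerivAt_integral_steinFn_add ν y)).hasDerivWithinAt) (fun y _ => h y) convex_univ
    (Set.mem_univ _) (Set.mem_univ _)
  simp only [Pi.sub_apply, add_zero, sub_zero, Real.norm_eq_abs] at this
  convert this using 2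
  ring

/-- The variance of |X| is nonnegative. -/
lemma integral_abs_le_of_integral_sq_le {Ω : Type*} [MeasurableSpace Ω] {P : Measure Ω}
    [IsProbabilityMeasure P] {X : Ω → ℝ} (hX : MemLp X 2 P) {δ : ℝ} (hδ : 0 ≤ δ)
    (h : ∫ ω, X ω ^ 2 ∂P ≤ δ ^ 2) : ∫ ω, |X ω| ∂P ≤ δ := by
  have hv := variance_nonneg (fun ω => |X ω|) P
  rw [variance_eq_sub (X := fun ω => |X ω|) hX.abs] at hv
  simp only [Pi.pow_apply, sq_abs] at hv
  exact abs_le_of_sq_le_sq' (by linarith) hδ |>.2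

/-! ### The inequality for one row -/

section Row

variable {Ω : Type*} [MeasurableSpace Ω] {P : Measure Ω} [IsProbabilityMeasure P]

/-- Integration by parts for one summand `X`, with `V` the sum of the others. -/
lemma integral_mul_steinFn_add_le {V X : Ω → ℝ} (hV : AEMeasurable V P) (hX : MemLp X 2 P)
    (hind : IndepFun V X P) (hmean : ∫ ω, X ω ∂P = 0) {C : ℝ}
    (hC : ∀ x, |∫ w, steinDeriv (w + x) ∂(P.map V) -
      ∫ z, steinDeriv (z + x) ∂gaussianReal 0 1| ≤ C) :
    ∫ ω, X ω * steinFn (V ω + X ω) ∂P ≤ (1 / 2 + C) * ∫ ω, X ω ^ 2 ∂P -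
      5 / 24 * ∫ ω, X ω ^ 2 * (1 - Real.exp (-(X ω ^ 2 / 2))) ∂P := by
  have hXm := hX.aestronglyMeasurable.aemeasurable
  have : IsProbabilityMeasure (P.map V) := Measure.isProbabilityMeasure_map hV
  have : IsProbabilityMeasure (P.map X) := Measure.isProbabilityMeasure_map hXm
  have hcont : Continuous fun p : ℝ × ℝ => p.2 * steinFn (p.1 + p.2) := by
    have := continuous_steinFn
    fun_prop
  have hid : Integrable (fun x : ℝ => x) (P.map X) := by
    rw [integrable_map_measure (by fun_prop) hXm]
    exact hX.integrable (by norm_num)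
  have hint : Integrable (fun p : ℝ × ℝ => p.2 * steinFn (p.1 + p.2))
      ((P.map V).prod (P.map X)) := by
    refine ((hid.comp_snd (P.map V)).mul_const (3 / 2)).mono hcont.aestronglyMeasurable
      (Eventually.of_forall fun p => ?_)
    rw [norm_mul, norm_mul]
    refine mul_le_mul_of_nonneg_left ?_ (norm_nonneg _)
    simpa using abs_steinFn_le _
  have hprod : ∫ ω, X ω * steinFn (V ω + X ω) ∂P =
      ∫ x, x * ∫ w, steinFn (w + x) ∂(P.map V) ∂(P.map X) := by
    have h1 := integral_map (hV.prodMk hXm) (f := fun p : ℝ × ℝ => p.2 * steinFn (p.1 + p.2))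
      hcont.aestronglyMeasurable
    rw [← h1, (indepFun_iff_map_prod_eq_prod_map_map hV hXm).1 hind, integral_prod_symm _ hint]
    simp only [integral_const_mul]
  have hi1 : Integrable (fun x => x * ∫ w, steinFn (w + x) ∂(P.map V)) (P.map X) := by
    have := hint.integral_prod_right
    simpa only [integral_const_mul] using this
  -- Since X is centred and independent of V, E f(V) can be subtracted at no cost, leaving an
  -- increment of f.
  have hmean' : ∫ x, x * ∫ w, steinFn w ∂(P.map V) ∂(P.map X) = 0 := by
    rw [integral_mul_const, integral_map hXm (by fun_prop), hmean, zero_mul]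
  have hsq : Integrable (fun ω => X ω ^ 2) P := hX.integrable_sq
  have hsqw : Integrable (fun ω => X ω ^ 2 * (1 - Real.exp (-(X ω ^ 2 / 2)))) P := by
    refine hsq.mono (by fun_prop) (Eventually.of_forall fun ω => ?_)
    rw [norm_mul]
    refine mul_le_of_le_one_right (norm_nonneg _) ?_
    rw [Real.norm_eq_abs, abs_le]
    have h0 : 0 ≤ X ω ^ 2 / 2 := by positivity
    have := Real.exp_le_one_iff.2 (neg_nonpos.2 h0)
    have := Real.exp_pos (-(X ω ^ 2 / 2))
    constructor <;> linarith
  have hrhs : Integrable (fun x : ℝ => (1 / 2 + C) * x ^ 2 -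
      5 / 24 * (x ^ 2 * (1 - Real.exp (-(x ^ 2 / 2))))) (P.map X) := by
    rw [integrable_map_measure (by fun_prop) hXm]
    exact (hsq.const_mul _).sub (hsqw.const_mul _)
  have hpt : ∀ x : ℝ, x * (∫ w, steinFn (w + x) ∂(P.map V)) - x * ∫ w, steinFn w ∂(P.map V) ≤
      (1 / 2 + C) * x ^ 2 - 5 / 24 * (x ^ 2 * (1 - Real.exp (-(x ^ 2 / 2)))) := by
    intro x
    have h1 := abs_integral_steinFn_increment_sub_le hC x
    rw [integral_steinFn_gaussianReal, sub_zero] at h1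
    have h2 := mul_integral_steinFn_add_gaussianReal_le x
    have h3 := mul_le_mul_of_nonneg_left h1 (abs_nonneg x)
    rw [← abs_mul, mul_left_comm, abs_mul_abs_self] at h3
    have h4 := (le_abs_self _).trans h3
    nlinarith
  calc ∫ ω, X ω * steinFn (V ω + X ω) ∂P
      = ∫ x, (x * (∫ w, steinFn (w + x) ∂(P.map V)) - x * ∫ w, steinFn w ∂(P.map V))
          ∂(P.map X) := by
        rw [integral_sub hi1 (hid.mul_const _), hmean', sub_zero, hprod]
    _ ≤ ∫ x, ((1 / 2 + C) * x ^ 2 - 5 / 24 * (x ^ 2 * (1 - Real.exp (-(x ^ 2 / 2)))))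
          ∂(P.map X) := integral_mono (hi1.sub (hid.mul_const _)) hrhs hpt
    _ = _ := by
        rw [integral_map hXm (by fun_prop), integral_sub (hsq.const_mul _) (hsqw.const_mul _),
          integral_const_mul, integral_const_mul]

/-- Putting the omitted summand back moves the argument of f' by X, and |f''| ≤ 17 while E|X| ≤ δ.
-/
lemma abs_integral_steinDeriv_map_sub_le {V X : Ω → ℝ} (hV : AEMeasurable V P) (hX : MemLp X 2 P)
    {δ : ℝ} (hδ : 0 ≤ δ) (hXδ : ∫ ω, X ω ^ 2 ∂P ≤ δ ^ 2) (x : ℝ) :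
    |∫ w, steinDeriv (w + x) ∂(P.map V) - ∫ w, steinDeriv (w + x) ∂(P.map (V + X))| ≤
      17 * δ := by
  have hXm := hX.aestronglyMeasurable.aemeasurable
  have hc : Continuous fun w => steinDeriv (w + x) :=
    continuous_steinDeriv.comp (continuous_add_const x)
  have hi : ∀ {Y : Ω → ℝ}, AEMeasurable Y P → Integrable (fun ω => steinDeriv (Y ω + x)) P :=
    fun hY => Integrable.of_bound (hc.measurable.comp_aemeasurable hY).aestronglyMeasurable 3
      (Eventually.of_forall fun _ => abs_steinDeriv_le _)
  rw [integral_map hV hc.aestronglyMeasurable,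
    integral_map (hV.add hXm) hc.aestronglyMeasurable, ← integral_sub (hi hV) (hi (hV.add hXm))]
  calc _ ≤ ∫ ω, 17 * |X ω| ∂P := by
        refine abs_integral_le_integral_abs.trans (integral_mono_of_nonneg
          (Eventually.of_forall fun _ => abs_nonneg _)
          ((hX.integrable (by norm_num)).abs.const_mul 17) (Eventually.of_forall fun ω => ?_))
        have := Convex.norm_image_sub_le_of_norm_hasDerivWithin_le (s := Set.univ)
          (x := (V + X) ω + x) (y := V ω + x)
          (fun y _ => (hasDerivAt_steinDeriv y).hasDerivWithinAt)
          (fun y _ => abs_steinDeriv₂_le y) convex_univ (Set.mem_univ _) (Set.mem_univ _)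
        simp only [Real.norm_eq_abs, Pi.add_apply] at this
        rw [show V ω + x - (V ω + X ω + x) = -X ω by ring, abs_neg] at this
        exact this
    _ ≤ 17 * δ := by
        rw [integral_const_mul]
        exact mul_le_mul_of_nonneg_left (integral_abs_le_of_integral_sq_le hX hδ hXδ)
          (by norm_num)

/-- The quantitative lower bound for the Kolmogorov distance of a sum of independent centred
random variables to the standard normal law. -/
theorem sum_integral_sq_mul_expWeight_le {ι : Type*} [Fintype ι] {X : ι → Ω → ℝ}
    (hX : ∀ i, MemLp (X i) 2 P) (hind : iIndepFun X P) (hmean : ∀ i, ∫ ω, X i ω ∂P = 0)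
    (hvar : ∑ i, ∫ ω, X i ω ^ 2 ∂P = 1) {κ δ : ℝ} (hδ : 0 ≤ δ)
    (hXδ : ∀ i, ∫ ω, X i ω ^ 2 ∂P ≤ δ ^ 2)
    (hκ : ∀ t, |(P.map (∑ i, X i)).real (Set.Iic t) -
      (gaussianReal 0 1).real (Set.Iic t)| ≤ κ) :
    5 / 24 * ∑ i, ∫ ω, X i ω ^ 2 * (1 - Real.exp (-(X i ω ^ 2 / 2))) ∂P ≤
      6.3125 * κ + 17 * δ := by
  classical
  have hXm : ∀ i, AEMeasurable (X i) P := fun i => (hX i).aestronglyMeasurable.aemeasurable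
  set W : Ω → ℝ := ∑ i, X i with hW
  have hWm : AEMeasurable W P := Finset.aemeasurable_sum _ fun i _ => hXm i
  have : IsProbabilityMeasure (P.map W) := Measure.isProbabilityMeasure_map hWm
  have hterm : ∀ i, ∫ ω, X i ω * steinFn (W ω) ∂P ≤
      (1 / 2 + (17 * δ + 4.3125 * κ)) * ∫ ω, X i ω ^ 2 ∂P -
      5 / 24 * ∫ ω, X i ω ^ 2 * (1 - Real.exp (-(X i ω ^ 2 / 2))) ∂P := by
    intro i
    set V : Ω → ℝ := ∑ j ∈ Finset.univ.erase i, X j with hV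
    have hVm : AEMeasurable V P := Finset.aemeasurable_sum _ fun i _ => hXm i
    have hVW : V + X i = W := Finset.sum_erase_add _ _ (Finset.mem_univ i)
    have hVX : IndepFun V (X i) P :=
      hind.indepFun_finsetSum_of_notMem₀ hXm (Finset.notMem_erase i _)
    have h := integral_mul_steinFn_add_le hVm (hX i) hVX (hmean i)
      (C := 17 * δ + 4.3125 * κ) fun x => by
        have h1 := abs_integral_steinDeriv_map_sub_le hVm (hX i) hδ (hXδ i) x
        rw [hVW] at h1
        exact (abs_sub_le _ _ _).trans (add_le_add h1 (abs_integral_steinDeriv_add_sub_le hκ x))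
    have hω : ∀ ω, V ω + X i ω = W ω := fun ω => congrFun hVW ω
    simpa only [hω] using h
  have hiXf : ∀ i, Integrable (fun ω => X i ω * steinFn (W ω)) P := fun i =>
    ((hX i).integrable (by norm_num)).mul_bdd (c := 3 / 2)
      (continuous_steinFn.measurable.comp_aemeasurable hWm).aestronglyMeasurable
      (Eventually.of_forall fun _ => abs_steinFn_le _)
  have hsum : ∫ w, w * steinFn w ∂(P.map W) = ∑ i, ∫ ω, X i ω * steinFn (W ω) ∂P := by
    rw [integral_map hWm (continuous_id'.fun_mul continuous_steinFn).aestronglyMeasurable,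
      ← integral_finsetSum _ fun i _ => hiXf i]
    refine integral_congr_ae (Eventually.of_forall fun ω => ?_)
    simp only
    rw [← Finset.sum_mul, ← Finset.sum_apply]
  have hle := Finset.sum_le_sum fun i (_ : i ∈ Finset.univ) => hterm i
  rw [← hsum, Finset.sum_sub_distrib, ← Finset.mul_sum, ← Finset.mul_sum, hvar] at hle
  have hlow := abs_integral_mul_steinFn_sub_le hκ
  rw [integral_mul_steinFn_gaussianReal] at hlow
  have := (abs_le.1 hlow).1
  linarith

end Row

/-! ### Passage to the limit along the array -/

lemma abs_sub_le_kolmogorovDist {Ω Ω' : Type*} [MeasurableSpace Ω] [MeasurableSpace Ω']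
    (P : Measure Ω) [IsProbabilityMeasure P] (X : Ω → ℝ)
    (Q : Measure Ω') [IsProbabilityMeasure Q] (Y : Ω' → ℝ) (x : ℝ) :
    |P.real {ω | X ω ≤ x} - Q.real {ω | Y ω ≤ x}| ≤ kolmogorovDist P X Q Y := by
  refine le_ciSup (f := fun x : ℝ => |P.real {ω | X ω ≤ x} - Q.real {ω | Y ω ≤ x}|)
    ⟨1, ?_⟩ x
  rintro _ ⟨y, rfl⟩
  rw [abs_le]
  constructor <;> linarith [measureReal_nonneg (μ := P) (s := {ω | X ω ≤ y}),
    measureReal_nonneg (μ := Q) (s := {ω | Y ω ≤ y}),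
    measureReal_le_one (μ := P) (s := {ω | X ω ≤ y}),
    measureReal_le_one (μ := Q) (s := {ω | Y ω ≤ y})]

lemma kolmogorovDist_le_one {Ω Ω' : Type*} [MeasurableSpace Ω] [MeasurableSpace Ω']
    (P : Measure Ω) [IsProbabilityMeasure P] (X : Ω → ℝ)
    (Q : Measure Ω') [IsProbabilityMeasure Q] (Y : Ω' → ℝ) : kolmogorovDist P X Q Y ≤ 1 := by
  refine ciSup_le fun y => ?_
  rw [abs_le]
  constructor <;> linarith [measureReal_nonneg (μ := P) (s := {ω | X ω ≤ y}),
    measureReal_nonneg (μ := Q) (s := {ω | Y ω ≤ y}),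
    measureReal_le_one (μ := P) (s := {ω | X ω ≤ y}),
    measureReal_le_one (μ := Q) (s := {ω | Y ω ≤ y})]

theorem theorem3p6 :
    ∃ C : ℝ, 0 < C ∧ C ≤ 30.3 ∧
      ∀ {Ω : ℕ → Type*} [∀ n, MeasurableSpace (Ω n)] (P : ∀ n, Measure (Ω n))
        [∀ n, IsProbabilityMeasure (P n)] (ξ : ∀ n, Fin n → Ω n → ℝ)
        {Ω' : Type*} [MeasurableSpace Ω'] (Q : Measure Ω') [IsProbabilityMeasure Q] (Z : Ω' → ℝ),
        IsStandardTriangularArray P ξ → FellerNegligible P ξ → HasLaw Z (gaussianReal 0 1) Q →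
          relaxedLindebergIndex (1 / 2) P ξ ≤
            C * limsup (fun n => kolmogorovDist Q Z (P n) (fun ω => ∑ k, ξ n k ω)) atTop := by
  refine ⟨30.3, by norm_num, le_rfl, ?_⟩
  intro Ω _ P _ ξ Ω' _ Q _ Z hξ hF hZ
  set κ : ℕ → ℝ := fun n => kolmogorovDist Q Z (P n) (fun ω => ∑ k, ξ n k ω) with hκ
  set δ : ℕ → ℝ := fun n => √(⨆ k : Fin n, ∫ ω, (ξ n k ω) ^ 2 ∂(P n)) with hδ
  have hδ0 : Tendsto δ atTop (𝓝 0) := by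
    have := (Real.continuous_sqrt.tendsto 0).comp hF
    rwa [Real.sqrt_zero] at this
  -- The row inequality multiplied by 24/5: 6.3125 · 24/5 = 30.3 and 17 · 24/5 = 81.6.
  have hrow : ∀ n, 1 ≤ n → ∑ k, ∫ ω, (ξ n k ω) ^ 2 * expWeight (1 / 2) |ξ n k ω| ∂(P n) ≤
      30.3 * κ n + 81.6 * δ n := by
    intro n hn
    have hm : ∀ k, AEMeasurable (ξ n k) (P n) := fun k =>
      (hξ.square_integrable n hn k).aestronglyMeasurable.aemeasurable
    have hδk : ∀ k, ∫ ω, (ξ n k ω) ^ 2 ∂(P n) ≤ δ n ^ 2 := fun k => by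
      have hk := le_ciSup (f := fun k : Fin n => ∫ ω, (ξ n k ω) ^ 2 ∂(P n))
        (Set.finite_range _).bddAbove k
      have h0 : 0 ≤ ∫ ω, (ξ n k ω) ^ 2 ∂(P n) := integral_nonneg fun _ => sq_nonneg _
      rw [hδ, Real.sq_sqrt (h0.trans hk)]
      exact hk
    have hcdf : ∀ t, |((P n).map (∑ k, ξ n k)).real (Set.Iic t) -
        (gaussianReal 0 1).real (Set.Iic t)| ≤ κ n := fun t => by
      have h := abs_sub_le_kolmogorovDist Q Z (P n) (fun ω => ∑ k, ξ n k ω) t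
      rw [abs_sub_comm] at h
      rw [← hZ.map_eq, map_measureReal_apply_of_aemeasurable
        (Finset.aemeasurable_sum _ fun k _ => hm k) measurableSet_Iic,
        map_measureReal_apply_of_aemeasurable hZ.aemeasurable measurableSet_Iic]
      simpa only [Set.preimage, Set.mem_Iic, Finset.sum_apply] using h
    have h := sum_integral_sq_mul_expWeight_le (hξ.square_integrable n hn) (hξ.indep n hn)
      (hξ.mean_zero n hn) (hξ.sum_variance n hn) (Real.sqrt_nonneg _) hδk hcdf
    have he : ∀ x : ℝ, expWeight (1 / 2) |x| = 1 - Real.exp (-(x ^ 2 / 2)) := fun x => by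
      rw [expWeight, sq_abs]; ring_nf
    simp only [he]
    linarith
  have hnonneg : ∀ n, 0 ≤ ∑ k, ∫ ω, (ξ n k ω) ^ 2 * expWeight (1 / 2) |ξ n k ω| ∂(P n) := by
    refine fun n => Finset.sum_nonneg fun k _ => integral_nonneg fun ω => ?_
    refine mul_nonneg (sq_nonneg _) (sub_nonneg.2 (Real.exp_le_one_iff.2 ?_))
    nlinarith [sq_nonneg |ξ n k ω|]
  have hbdd : IsBoundedUnder (· ≤ ·) atTop κ :=
    isBoundedUnder_of ⟨1, fun n => kolmogorovDist_le_one _ _ _ _⟩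
  refine le_of_forall_pos_le_add fun ε hε => ?_
  -- The two errors add up to at most 30.3 ε/100 + 81.6 ε/200 < ε.
  have hκε : ∀ᶠ n in atTop, κ n < limsup κ atTop + ε / 100 :=
    eventually_lt_of_limsup_lt (by linarith [div_pos hε (by norm_num : (0 : ℝ) < 100)]) hbdd
  have hδε : ∀ᶠ n in atTop, δ n < ε / 200 :=
    hδ0.eventually_lt_const (by positivity)
  refine limsup_le_of_le (isCoboundedUnder_le_of_le atTop hnonneg) ?_
  filter_upwards [hκε, hδε, eventually_ge_atTop 1] with n h1 h2 h3
  refine (hrow n h3).trans ?_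
  linarith

end
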